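/- Let $K$ be a commutative ring of coefficients of one of the following two kinds, and let $\Phi(u,v)=\sum_{m,n\ge 0}c_{mn}u^mv^n\in K[[u,v]]$ be a double power series: (a) $K$ is a complete normed commutative $\mathbb{Q}$-algebra (for example $\mathbb{R}$ or $\mathbb{C}$), and $\Phi$ is arbitrary; or (b) $K$ is any commutative $\mathbb{Q}$-algebra, and $\Phi(0,0)=c_{00}=0$. For a power series $f(z)=a+g(z)$ with $a\in K$ and $g(0)=0$ put $\exp(f)=e^{a}\sum_{n\ge 0}g(z)^n/n!$, where $e^a=\sum_{n\ge0} a^n/n!$ is the convergent sum in $K$ in case (a), while in case (b) only $a=0$, $e^0=1$ occurs. For a power series $F(t,z)$ with constant term $1$ put $\log F=\sum_{n\ge 1}(-1)^{n+1}(F-1)^n/n$. Then there is a power series $\Psi(u,v)\in K[[u,v]]$ such that, in $K[[t,z]]$, $$\log\left(\sum_{k=0}^{\infty}\frac{t^k}{k!}\exp\bigl(k\,\Phi(kz,z)\bigr)\right)=t\,\Psi(tz,z).$$ Equivalently, the left side has the form $\sum_{n\ge 0}t^{n+1}\theta_n(z)$, where each $\theta_n(z)\in K[[z]]$ contains no power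 of $z$ with exponent less than $n$. -/

import Mathlib

/-! Formal power series used in the statement. In `MvPowerSeries (Fin 2) K` the two variables
are `(u, v)` for `Φ` and `Ψ`, and `(t, z)` for the identity itself. In `PowerSeries K` the
variable is `z`. -/

namespace BouwkampDeBruijn

noncomputable section

open PowerSeries (C X)
open scoped Nat

/-- The power series `k Φ(k z, z)` in `z`. -/
def exponent {K : Type*} [CommRing K] (Φ : MvPowerSeries (Fin 2) K) (k : ℕ) : PowerSeries K :=
  (k : K) • (MvPowerSeries.subst (![(k : K) • X, X] : Fin 2 → PowerSeries K) Φ : PowerSeries K)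

/-- The formal exponential `∑ fⁿ / n!` of a power series `f` in `z` whose constant term is `0`. -/
def formalExp {K : Type*} [CommRing K] [Algebra ℚ K] (f : PowerSeries K) : PowerSeries K :=
  (PowerSeries.exp K).subst f

/-- The exponential of an arbitrary power series `f = a + g`, with `a` constant and `g` without
constant term, over a normed ring: `exp f = exp a * ∑ gⁿ / n!`, where `exp a` is the sum of the
convergent exponential series in `K`. -/
def analyticExp {K : Type*} [NormedCommRing K] [NormedAlgebra ℚ K] (f : PowerSeries K) :
    PowerSeries K :=
  C (NormedSpace.exp (PowerSeries.constantCoeff f)) *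
    formalExp (f - C (PowerSeries.constantCoeff f))

/-- The series `∑ₖ tᵏ / k! * A k (z)` in `t` and `z`: the coefficient of `tᵏ zʲ` is the
coefficient of `zʲ` in `A k`, divided by `k!`. -/
def expGenFun {K : Type*} [CommRing K] [Algebra ℚ K] (A : ℕ → PowerSeries K) :
    MvPowerSeries (Fin 2) K :=
  fun d ↦ (1 / ((d 0)! : ℚ)) • PowerSeries.coeff (d 1) (A (d 0))

/-- The formal logarithm `∑_{n ≥ 1} (-1)ⁿ⁺¹ (F - 1)ⁿ / n` of a series `F` in `t` and `z` with
constant term `1`. -/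
def formalLog {K : Type*} [CommRing K] [Algebra ℚ K] (F : MvPowerSeries (Fin 2) K) :
    MvPowerSeries (Fin 2) K :=
  (PowerSeries.log K).subst (F - 1)

/-- The series `t Ψ(t z, z)` in `t` and `z`. -/
def tPsi {K : Type*} [CommRing K] (Ψ : MvPowerSeries (Fin 2) K) : MvPowerSeries (Fin 2) K :=
  MvPowerSeries.X 0 * MvPowerSeries.subst
    (![MvPowerSeries.X 0 * MvPowerSeries.X 1, MvPowerSeries.X 1] :
      Fin 2 → MvPowerSeries (Fin 2) K) Ψ

/-- The coefficient of `tⁱ zʲ` in a series in `t` and `z`. -/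
def coeffTZ {K : Type*} [CommRing K] (i j : ℕ) (F : MvPowerSeries (Fin 2) K) : K :=
  MvPowerSeries.coeff (Finsupp.single 0 i + Finsupp.single 1 j) F

end

end BouwkampDeBruijn

open BouwkampDeBruijn

/-! Write `L` for the logarithm and `F = exp L`. Expanding `k Φ(k z, z) = ∑ P_p(k) z^p`, where
`P_p` is a polynomial of degree at most `p + 1`, and using that `t ∂/∂t` multiplies `t^k` by `k`,
one gets `z ∂F/∂z = ∑ p z^p P_p(t ∂/∂t) F`. Dividing by `F` replaces `t ∂/∂t` by its conjugate
`t ∂/∂t + t ∂L/∂t`, so that `z ∂L/∂z = ∑ p z^p P_p(t ∂/∂t + t ∂L/∂t) 1`. The claim is that in each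
term of `L` the `t`-degree exceeds the `z`-degree by at most `1`. If this holds up to some
`z`-degree, then `P_p(t ∂/∂t + t ∂L/∂t) 1` has excess at most `p + 1` there, and the factor `z^p`
with `p ≥ 1` lowers the excess to `1` and yields the claim one `z`-degree further. The induction
starts from `L = w t` modulo `z`, where `w = exp (Φ(0, 0))`. -/

namespace BouwkampDeBruijn

noncomputable section

open Polynomial (aeval)
open PowerSeries (derivative)
open MvPowerSeries (coeff constantCoeff)
open scoped Nat

section Intertwining

variable {R M N : Type*} [CommSemiring R] [AddCommMonoid M] [AddCommMonoid N] [Module R M]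
  [Module R N]

theorem map_aeval_end_apply_of_intertwines {T : Module.End R M} {S : Module.End R N}
    (g : M →ₗ[R] N) (h : ∀ m, g (T m) = S (g m)) (q : Polynomial R) (m : M) :
    g (aeval T q m) = aeval S q (g m) := by
  have hpow (n : ℕ) : g ((T ^ n) m) = (S ^ n) (g m) := by
    induction n with
    | zero => simp
    | succ n ih => simp only [pow_succ', Module.End.mul_apply, h, ih]
  simp only [Polynomial.aeval_eq_sum_range, LinearMap.sum_apply, LinearMap.smul_apply, map_sum,
    map_smul, hpow]

end Intertwining

section Substitution

variable {σ K : Type*} [CommRing K]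

theorem eq_zero_of_forall_pow_dvd {a f : MvPowerSeries σ K} (ha : constantCoeff a = 0)
    (h : ∀ n : ℕ, a ^ n ∣ f) : f = 0 := by
  rw [← MvPowerSeries.order_eq_top_iff, ENat.eq_top_iff_forall_ge]
  intro n
  obtain ⟨g, rfl⟩ := h n
  calc (n : ℕ∞) ≤ (a ^ n).order := MvPowerSeries.le_order_pow_of_constantCoeff_eq_zero n ha
    _ ≤ (a ^ n).order + g.order := le_self_add
    _ ≤ (a ^ n * g).order := MvPowerSeries.le_order_mul

theorem derivation_subst (D : Derivation K (MvPowerSeries σ K) (MvPowerSeries σ K))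
    {a : MvPowerSeries σ K} (ha : constantCoeff a = 0) (f : PowerSeries K) :
    D (f.subst a) = (derivative K f).subst a * D a := by
  have hs : PowerSeries.HasSubst a := PowerSeries.HasSubst.of_constantCoeff_zero ha
  let defect (f : PowerSeries K) := D (f.subst a) - (derivative K f).subst a * D a
  have defect_X_mul_add_C (g : PowerSeries K) (c : K) :
      defect (PowerSeries.X * g + PowerSeries.C c) = a * defect g := by
    simp only [defect, map_add, Derivation.leibniz, PowerSeries.derivative_X,
      PowerSeries.derivative_C, PowerSeries.subst_add hs, PowerSeries.subst_mul hs,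
      PowerSeries.subst_X hs, PowerSeries.subst_C, MvPowerSeries.c_eq_algebraMap,
      Derivation.map_algebraMap, smul_eq_mul, mul_one, add_zero]
    ring
  have pow_dvd_defect (n : ℕ) : ∀ f, a ^ n ∣ defect f := by
    induction n with
    | zero => simp
    | succ n ih =>
      intro f
      rw [PowerSeries.eq_X_mul_shift_add_const f, defect_X_mul_add_C, pow_succ']
      exact mul_dvd_mul_left a (ih _)
  exact sub_eq_zero.1 (eq_zero_of_forall_pow_dvd ha fun n ↦ pow_dvd_defect n f)

end Substitution

section Euler

variable {σ K : Type*} [CommRing K]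

/-- The Euler derivation `X s * ∂ / ∂ X s`, which multiplies a monomial by its degree in `X s`. -/
def euler (s : σ) : Derivation K (MvPowerSeries σ K) (MvPowerSeries σ K) :=
  (MvPowerSeries.X s : MvPowerSeries σ K) • MvPowerSeries.pderiv K s

theorem coeff_X_pow_mul_eq_ite (s : σ) (n : ℕ) (f : MvPowerSeries σ K) (d : σ →₀ ℕ) :
    coeff d (MvPowerSeries.X s ^ n * f)
      = if n ≤ d s then coeff (d - Finsupp.single s n) f else 0 := by
  classical
  simp [MvPowerSeries.X_pow_eq, MvPowerSeries.coeff_monomial_mul, Finsupp.single_le_iff]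

theorem coeff_X_mul_eq_ite (s : σ) (f : MvPowerSeries σ K) (d : σ →₀ ℕ) :
    coeff d (MvPowerSeries.X s * f)
      = if 1 ≤ d s then coeff (d - Finsupp.single s 1) f else 0 := by
  simpa only [pow_one] using coeff_X_pow_mul_eq_ite s 1 f d

theorem coeff_euler (s : σ) (f : MvPowerSeries σ K) (d : σ →₀ ℕ) :
    coeff d (euler s f) = d s * coeff d f := by
  rw [euler, Derivation.smul_apply, smul_eq_mul, coeff_X_mul_eq_ite]
  split_ifs with hd
  · have hsingle : Finsupp.single s 1 ≤ d := Finsupp.single_le_iff.2 hd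
    rw [MvPowerSeries.coeff_pderiv, tsub_add_cancel_of_le hsingle, mul_comm]
    simp [Nat.cast_sub hd]
  · simp [Nat.lt_one_iff.1 (not_le.1 hd)]

theorem coeff_aeval_euler (s : σ) (q : Polynomial K) (f : MvPowerSeries σ K) (d : σ →₀ ℕ) :
    coeff d (aeval (euler s).toLinearMap q f) = q.eval (d s : K) * coeff d f := by
  have h := map_aeval_end_apply_of_intertwines (coeff d)
    (S := algebraMap K (Module.End K K) (d s : K)) (coeff_euler s · d) q f
  rwa [Polynomial.aeval_algebraMap_apply, Polynomial.coe_aeval_eq_eval] at h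

/-- The operator `X s * ∂ / ∂ X s + (X s * ∂ L / ∂ X s)`, that is, `exp (-L)` composed with
`X s * ∂ / ∂ X s` composed with `exp L`. -/
def conjEuler (s : σ) (L : MvPowerSeries σ K) : Module.End K (MvPowerSeries σ K) :=
  (euler s).toLinearMap + LinearMap.mulLeft K (euler s L)

theorem conjEuler_apply (s : σ) (L f : MvPowerSeries σ K) :
    conjEuler s L f = euler s f + euler s L * f := rfl

theorem mul_aeval_conjEuler {s : σ} {F L : MvPowerSeries σ K}
    (h : euler s L * F = euler s F) (q : Polynomial K) (g : MvPowerSeries σ K) :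
    F * aeval (conjEuler s L) q g = aeval (euler s).toLinearMap q (F * g) := by
  refine map_aeval_end_apply_of_intertwines (LinearMap.mulLeft K F) (fun f ↦ ?_) q g
  simp only [LinearMap.mulLeft_apply, conjEuler_apply, Derivation.coeFn_coe, Derivation.leibniz,
    smul_eq_mul, ← h]
  ring

end Euler

section Log

variable {K : Type*} [CommRing K] [Algebra ℚ K]

theorem derivative_log_mul_one_add_X :
    derivative K (PowerSeries.log K) * (1 + PowerSeries.X) = 1 := by
  rw [PowerSeries.deriv_log]
  ext n
  cases n with
  | zero => simp
  | succ n => simp [mul_add, PowerSeries.coeff_succ_mul_X, pow_succ, PowerSeries.coeff_one]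

theorem derivation_formalLog_mul
    (D : Derivation K (MvPowerSeries (Fin 2) K) (MvPowerSeries (Fin 2) K))
    {F : MvPowerSeries (Fin 2) K} (hF : constantCoeff F = 1) :
    D (formalLog F) * F = D F := by
  have ha : constantCoeff (F - 1) = 0 := by simp [hF]
  have hs : PowerSeries.HasSubst (F - 1) := PowerSeries.HasSubst.of_constantCoeff_zero ha
  have hlog : (derivative K (PowerSeries.log K)).subst (F - 1) * F = 1 := by
    have h := congrArg (PowerSeries.substAlgHom (R := K) hs) derivative_log_mul_one_add_X
    simpa only [map_mul, map_add, map_one, PowerSeries.substAlgHom_X,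
      PowerSeries.coe_substAlgHom hs, add_sub_cancel] using h
  rw [formalLog, derivation_subst D ha, mul_right_comm, hlog, one_mul, map_sub,
    Derivation.map_one_eq_zero, sub_zero]

theorem X_dvd_formalLog {F : MvPowerSeries (Fin 2) K} {s : Fin 2}
    (hF : MvPowerSeries.X s ∣ F - 1) : MvPowerSeries.X s ∣ formalLog F := by
  have hs : PowerSeries.HasSubst (F - 1) := by
    obtain ⟨g, hg⟩ := hF
    exact PowerSeries.HasSubst.of_constantCoeff_zero (by simp [hg])
  obtain ⟨g, hg⟩ : PowerSeries.X ∣ PowerSeries.log K :=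
    PowerSeries.X_dvd_iff.2 PowerSeries.constantCoeff_log
  rw [formalLog, hg, PowerSeries.subst_mul hs, PowerSeries.subst_X hs]
  exact hF.mul_right _

end Log

section Excess

variable {K : Type*} [CommRing K]

/-- The series in `t` and `z` in whose part of `z`-degree less than `J` the `t`-degree exceeds the
`z`-degree by at most `r`. -/
def excessLE (r J : ℕ) : Submodule K (MvPowerSeries (Fin 2) K) where
  carrier := {f | ∀ d : Fin 2 →₀ ℕ, d 1 < J → d 1 + r < d 0 → coeff d f = 0}
  zero_mem' _ _ _ := map_zero _
  add_mem' hf hg d hJ hr := by rw [map_add, hf d hJ hr, hg d hJ hr, add_zero]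
  smul_mem' c f hf d hJ hr := by rw [map_smul, hf d hJ hr, smul_zero]

variable {r s J : ℕ} {f g : MvPowerSeries (Fin 2) K}

theorem excessLE_mono (h : r ≤ s) : excessLE r J ≤ (excessLE s J : Submodule K _) :=
  fun _ hf d hJ hs ↦ hf d hJ (by omega)

theorem one_mem_excessLE : (1 : MvPowerSeries (Fin 2) K) ∈ excessLE 0 J := by
  classical
  intro d _ hd
  rw [MvPowerSeries.coeff_one, if_neg]
  rintro rfl
  simp at hd

theorem X_zero_mem_excessLE :
    (MvPowerSeries.X 0 : MvPowerSeries (Fin 2) K) ∈ excessLE 1 J := by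
  classical
  intro d _ hd
  rw [MvPowerSeries.coeff_X, if_neg]
  rintro rfl
  simp at hd

theorem mul_mem_excessLE (hf : f ∈ excessLE r J) (hg : g ∈ excessLE s J) :
    f * g ∈ excessLE (r + s) J := by
  classical
  intro d hJ hd
  rw [MvPowerSeries.coeff_mul]
  refine Finset.sum_eq_zero fun p hp ↦ ?_
  have hsum (i : Fin 2) : p.1 i + p.2 i = d i :=
    DFunLike.congr_fun (Finset.HasAntidiagonal.mem_antidiagonal.1 hp) i
  have h0 := hsum 0
  have h1 := hsum 1
  by_cases hp1 : p.1 1 + r < p.1 0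
  · rw [hf _ (by omega) hp1, zero_mul]
  · rw [hg _ (by omega) (by omega), mul_zero]

theorem euler_mem_excessLE (i : Fin 2) (hf : f ∈ excessLE r J) : euler i f ∈ excessLE r J :=
  fun d hJ hd ↦ by rw [coeff_euler, hf d hJ hd, mul_zero]

theorem X_one_pow_mul_mem_excessLE {p : ℕ} (hf : f ∈ excessLE (r + p) J) :
    MvPowerSeries.X 1 ^ p * f ∈ excessLE r (J + p) := by
  intro d hJ hd
  rw [coeff_X_pow_mul_eq_ite]
  split_ifs with hp
  · exact hf _ (by simp; omega) (by simp; omega)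
  · rfl

theorem mem_excessLE_of_X_one_pow_dvd_sub (h : MvPowerSeries.X 1 ^ J ∣ f - g)
    (hg : g ∈ excessLE r J) : f ∈ excessLE r J := by
  intro d hJ hd
  have hcoeff := MvPowerSeries.X_pow_dvd_iff.1 h d hJ
  rwa [map_sub, hg d hJ hd, sub_zero] at hcoeff

theorem aeval_conjEuler_one_mem_excessLE (hf : f ∈ excessLE 1 J) (q : Polynomial K) :
    aeval (conjEuler 0 f) q 1 ∈ excessLE q.natDegree J := by
  have hpow (n : ℕ) : (conjEuler 0 f ^ n) 1 ∈ excessLE n J := by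
    induction n with
    | zero => exact one_mem_excessLE
    | succ n ih =>
      rw [pow_succ', Module.End.mul_apply, conjEuler_apply]
      refine add_mem (excessLE_mono n.le_succ (euler_mem_excessLE 0 ih)) ?_
      rw [add_comm n 1]
      exact mul_mem_excessLE (euler_mem_excessLE 0 hf) ih
  rw [Polynomial.aeval_eq_sum_range, LinearMap.sum_apply]
  refine sum_mem fun n hn ↦ Submodule.smul_mem _ _ ?_
  exact excessLE_mono (Nat.lt_succ_iff.1 (Finset.mem_range.1 hn)) (hpow n)

section TorsionFree

variable [IsAddTorsionFree K]

theorem coeff_eq_zero_of_coeff_euler_eq_zero {σ : Type*} {i : σ} {f : MvPowerSeries σ K}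
    {d : σ →₀ ℕ} (hd : d i ≠ 0) (h : coeff d (euler i f) = 0) : coeff d f = 0 := by
  rw [coeff_euler, ← nsmul_eq_mul] at h
  exact (smul_eq_zero.1 h).resolve_left hd

theorem mem_excessLE_of_euler_zero_mem (h : euler 0 f ∈ excessLE r J) : f ∈ excessLE r J :=
  fun d hJ hd ↦ coeff_eq_zero_of_coeff_euler_eq_zero (by omega) (h d hJ hd)

theorem mem_excessLE_of_euler_one_mem (h0 : f ∈ excessLE r 1) (h : euler 1 f ∈ excessLE r J) :
    f ∈ excessLE r J := by
  intro d hJ hd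
  by_cases hd1 : d 1 = 0
  · exact h0 d (by omega) hd
  · exact coeff_eq_zero_of_coeff_euler_eq_zero hd1 (h d hJ hd)

end TorsionFree

end Excess

section Evolution

variable {K : Type*} [CommRing K]

/-- The sum `∑_{1 ≤ p ≤ J} p z^p P_p(T) f`, whose limit for `J → ∞` is the right-hand side of the
evolution equation in `z`. It is truncated because multiplication by a series is easier to carry
through finite sums; the index in the code is `p - 1`. -/
def evolution (P : ℕ → Polynomial K) (T : Module.End K (MvPowerSeries (Fin 2) K)) (J : ℕ)
    (f : MvPowerSeries (Fin 2) K) : MvPowerSeries (Fin 2) K :=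
  ∑ p ∈ Finset.range J, (p + 1) • (MvPowerSeries.X 1 ^ (p + 1) * aeval T (P (p + 1)) f)

theorem mul_evolution_conjEuler {F L : MvPowerSeries (Fin 2) K}
    (h : euler 0 L * F = euler 0 F) (P : ℕ → Polynomial K) (J : ℕ) :
    F * evolution P (conjEuler 0 L) J 1 = evolution P (euler 0).toLinearMap J F := by
  simp only [evolution, Finset.mul_sum, mul_smul_comm, mul_left_comm F, mul_aeval_conjEuler h,
    mul_one]

theorem evolution_conjEuler_one_mem_excessLE {P : ℕ → Polynomial K}
    (hP : ∀ p, (P p).natDegree ≤ p + 1) {J : ℕ} {L : MvPowerSeries (Fin 2) K}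
    (hL : L ∈ excessLE 1 J) : evolution P (conjEuler 0 L) J 1 ∈ excessLE 1 (J + 1) := by
  refine sum_mem fun p _ ↦ nsmul_mem ?_ _
  have hPL : aeval (conjEuler 0 L) (P (p + 1)) 1 ∈ excessLE (1 + (p + 1)) J :=
    excessLE_mono ((hP (p + 1)).trans_eq (add_comm _ _)) (aeval_conjEuler_one_mem_excessLE hL _)
  exact fun d hJ hd ↦ X_one_pow_mul_mem_excessLE hPL d (by omega) hd

theorem mem_excessLE_of_evolution [IsAddTorsionFree K] {P : ℕ → Polynomial K}
    (hP : ∀ p, (P p).natDegree ≤ p + 1) {L : MvPowerSeries (Fin 2) K} (hL : L ∈ excessLE 1 1)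
    (hevol : ∀ J, MvPowerSeries.X 1 ^ (J + 1) ∣ euler 1 L - evolution P (conjEuler 0 L) J 1)
    (J : ℕ) : L ∈ excessLE 1 J := by
  induction J with
  | zero => exact fun d hJ ↦ absurd hJ (Nat.not_lt_zero _)
  | succ J ih =>
    exact mem_excessLE_of_euler_one_mem hL <| mem_excessLE_of_X_one_pow_dvd_sub (hevol J) <|
      evolution_conjEuler_one_mem_excessLE hP ih

end Evolution

section ExpGenFun

variable {K : Type*} [CommRing K] [Algebra ℚ K]

theorem coeff_expGenFun (A : ℕ → PowerSeries K) (d : Fin 2 →₀ ℕ) :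
    coeff d (expGenFun A) = (1 / ((d 0)! : ℚ)) • PowerSeries.coeff (d 1) (A (d 0)) := rfl

/-- The generating function `expGenFun` as a linear function of the family. -/
def expGenFunLinearMap : (ℕ → PowerSeries K) →ₗ[K] MvPowerSeries (Fin 2) K where
  toFun := expGenFun
  map_add' A B := by ext d; simp [coeff_expGenFun]
  map_smul' c A := by ext d; simp [coeff_expGenFun]

theorem expGenFunLinearMap_apply (A : ℕ → PowerSeries K) :
    expGenFunLinearMap A = expGenFun A := rfl

theorem constantCoeff_expGenFun (A : ℕ → PowerSeries K) :
    constantCoeff (expGenFun A) = PowerSeries.constantCoeff (A 0) := by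
  rw [← MvPowerSeries.coeff_zero_eq_constantCoeff_apply, coeff_expGenFun]
  simp

theorem euler_one_expGenFun (A : ℕ → PowerSeries K) :
    euler 1 (expGenFun A) = expGenFun fun k ↦ PowerSeries.X * derivative K (A k) := by
  ext d
  rw [coeff_euler, coeff_expGenFun, coeff_expGenFun, mul_smul_comm]
  congr 1
  cases d 1 with
  | zero => simp
  | succ j => rw [PowerSeries.coeff_succ_X_mul, PowerSeries.coeff_derivative, mul_comm,
      Nat.cast_succ]

theorem aeval_euler_zero_expGenFun (q : Polynomial K) (A : ℕ → PowerSeries K) :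
    aeval (euler 0).toLinearMap q (expGenFun A) = expGenFun fun k ↦ q.eval (k : K) • A k := by
  ext d
  rw [coeff_aeval_euler, coeff_expGenFun, coeff_expGenFun, mul_smul_comm, PowerSeries.coeff_smul,
    smul_eq_mul]

theorem X_one_pow_mul_expGenFun (p : ℕ) (A : ℕ → PowerSeries K) :
    MvPowerSeries.X 1 ^ p * expGenFun A = expGenFun fun k ↦ PowerSeries.X ^ p * A k := by
  ext d
  rw [coeff_X_pow_mul_eq_ite, coeff_expGenFun, coeff_expGenFun, PowerSeries.coeff_X_pow_mul']
  split_ifs <;> simp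

theorem X_one_pow_dvd_expGenFun {A : ℕ → PowerSeries K} {n : ℕ}
    (hA : ∀ k, PowerSeries.X ^ n ∣ A k) : MvPowerSeries.X 1 ^ n ∣ expGenFun A := by
  choose B hB using hA
  rw [funext hB, ← X_one_pow_mul_expGenFun]
  exact dvd_mul_right _ _

theorem X_zero_dvd_expGenFun_sub_one {A : ℕ → PowerSeries K} (hA : A 0 = 1) :
    MvPowerSeries.X 0 ∣ expGenFun A - 1 := by
  classical
  rw [MvPowerSeries.X_dvd_iff]
  intro d hd
  rw [map_sub, coeff_expGenFun, hd, hA, MvPowerSeries.coeff_one, PowerSeries.coeff_one]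
  simp [Finsupp.ext_iff, Fin.forall_fin_two, hd]

/-- Modulo `z` the series `expGenFun A` is `exp (w t)`. -/
theorem X_one_dvd_euler_zero_expGenFun_sub {A : ℕ → PowerSeries K} {w : K}
    (hA : ∀ k, PowerSeries.constantCoeff (A k) = w ^ k) :
    MvPowerSeries.X 1 ∣ euler 0 (expGenFun A) - w • MvPowerSeries.X 0 * expGenFun A := by
  rw [MvPowerSeries.X_dvd_iff]
  intro d hd
  rw [map_sub, coeff_euler, smul_mul_assoc, MvPowerSeries.coeff_smul, coeff_X_mul_eq_ite]
  simp only [coeff_expGenFun, Finsupp.tsub_apply, hd, Finsupp.single_eq_same, ne_eq,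
    one_ne_zero, not_false_eq_true, Finsupp.single_eq_of_ne, tsub_zero,
    PowerSeries.coeff_zero_eq_constantCoeff_apply, hA]
  cases d 0 with
  | zero => simp
  | succ k =>
    have hfactorial : ((k + 1 : ℕ) : ℚ) * (1 / ((k + 1)! : ℚ)) = 1 / (k ! : ℚ) := by
      rw [Nat.factorial_succ]
      push_cast
      field_simp
    rw [if_pos (by omega), Nat.add_sub_cancel, ← nsmul_eq_mul, ← Nat.cast_smul_eq_nsmul ℚ,
      smul_smul, hfactorial, mul_smul_comm, ← pow_succ', sub_self]

end ExpGenFun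

section Logarithm

theorem X_pow_dvd_X_mul_derivative_sub_sum {K : Type*} [CommRing K] {f A : PowerSeries K}
    (h : derivative K A = derivative K f * A) (J : ℕ) :
    PowerSeries.X ^ (J + 1) ∣ PowerSeries.X * derivative K A - ∑ p ∈ Finset.range J,
      (p + 1) • (PowerSeries.X ^ (p + 1) * (PowerSeries.coeff (p + 1) f • A)) := by
  set S : PowerSeries K := ∑ p ∈ Finset.range J,
    (p + 1) • (PowerSeries.coeff (p + 1) f • PowerSeries.X ^ p) with hS
  have hdvd : PowerSeries.X ^ J ∣ derivative K f - S := by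
    rw [PowerSeries.X_pow_dvd_iff]
    intro n hn
    have hcoeff : PowerSeries.coeff n S = (n + 1) • PowerSeries.coeff (n + 1) f := by
      simp [hS, -nsmul_eq_mul, PowerSeries.coeff_X_pow, hn]
    rw [map_sub, PowerSeries.coeff_derivative, hcoeff, nsmul_eq_mul, Nat.cast_succ, mul_comm,
      sub_self]
  have hfactor : PowerSeries.X * derivative K A - ∑ p ∈ Finset.range J,
      (p + 1) • (PowerSeries.X ^ (p + 1) * (PowerSeries.coeff (p + 1) f • A))
      = PowerSeries.X * (derivative K f - S) * A := by
    rw [h, mul_sub, sub_mul, mul_assoc, hS, Finset.mul_sum, Finset.sum_mul]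
    simp only [mul_smul_comm, smul_mul_assoc, pow_succ']
  rw [hfactor, pow_succ']
  exact (mul_dvd_mul_left _ hdvd).mul_right _

variable {K : Type*} [CommRing K] [Algebra ℚ K] {A : ℕ → PowerSeries K} {P : ℕ → Polynomial K}

theorem X_one_pow_dvd_euler_one_expGenFun_sub
    (hA : ∀ k : ℕ, derivative K (A k)
      = derivative K (PowerSeries.mk fun p ↦ (P p).eval (k : K)) * A k) (J : ℕ) :
    MvPowerSeries.X 1 ^ (J + 1) ∣
      euler 1 (expGenFun A) - evolution P (euler 0).toLinearMap J (expGenFun A) := by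
  have hdvd := X_one_pow_dvd_expGenFun fun k ↦
    X_pow_dvd_X_mul_derivative_sub_sum (hA k) J
  convert hdvd using 1
  simp only [PowerSeries.coeff_mk, evolution, aeval_euler_zero_expGenFun, X_one_pow_mul_expGenFun,
    euler_one_expGenFun]
  simp only [← expGenFunLinearMap_apply, ← map_nsmul, ← map_sum, ← map_sub]
  congr 1
  ext1 k
  simp

theorem formalLog_expGenFun_mem_excessLE {w : K}
    (hP : ∀ p, (P p).natDegree ≤ p + 1) (hw : ∀ k, PowerSeries.constantCoeff (A k) = w ^ k)
    (hA : ∀ k : ℕ, derivative K (A k)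
      = derivative K (PowerSeries.mk fun p ↦ (P p).eval (k : K)) * A k) (J : ℕ) :
    formalLog (expGenFun A) ∈ excessLE 1 J := by
  have : IsAddTorsionFree K := .of_module_rat K
  set F := expGenFun A
  set L := formalLog F
  have hF : constantCoeff F = 1 := by rw [constantCoeff_expGenFun, hw, pow_zero]
  have hunit : IsUnit F := by
    rw [MvPowerSeries.isUnit_iff_constantCoeff, hF]
    exact isUnit_one
  have hlog (i : Fin 2) : euler i L * F = euler i F := derivation_formalLog_mul _ hF
  have hinit : L ∈ excessLE 1 1 := by
    have hdvd := X_one_dvd_euler_zero_expGenFun_sub hw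
    rw [← hlog, ← sub_mul, hunit.dvd_mul_right, ← pow_one (MvPowerSeries.X 1)] at hdvd
    exact mem_excessLE_of_euler_zero_mem <| mem_excessLE_of_X_one_pow_dvd_sub hdvd <|
      Submodule.smul_mem _ w X_zero_mem_excessLE
  refine mem_excessLE_of_evolution hP hinit (fun J ↦ ?_) J
  have hdvd := X_one_pow_dvd_euler_one_expGenFun_sub hA J
  rwa [← mul_evolution_conjEuler (hlog 0), ← hlog 1, mul_comm _ F, ← mul_sub,
    hunit.dvd_mul_left] at hdvd

end Logarithm

section Psi

variable {K : Type*} [CommRing K]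

theorem single_zero_add_single_one (d : Fin 2 →₀ ℕ) :
    Finsupp.single 0 (d 0) + Finsupp.single 1 (d 1) = d := by
  ext i
  fin_cases i <;> simp

theorem ext_coeffTZ {F G : MvPowerSeries (Fin 2) K} (h : ∀ i j, coeffTZ i j F = coeffTZ i j G) :
    F = G := by
  ext d
  simpa only [coeffTZ, single_zero_add_single_one] using h (d 0) (d 1)

theorem coeffTZ_subst_X_mul_X (Ψ : MvPowerSeries (Fin 2) K) (i j : ℕ) :
    coeffTZ i j (MvPowerSeries.subst (![MvPowerSeries.X 0 * MvPowerSeries.X 1,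
      MvPowerSeries.X 1] : Fin 2 → MvPowerSeries (Fin 2) K) Ψ)
      = if i ≤ j then coeffTZ i (j - i) Ψ else 0 := by
  classical
  have hprod (m : Fin 2 →₀ ℕ) : coeff (Finsupp.single 0 i + Finsupp.single 1 j) (m.prod fun s n ↦
      (![MvPowerSeries.X 0 * MvPowerSeries.X 1, MvPowerSeries.X 1] :
        Fin 2 → MvPowerSeries (Fin 2) K) s ^ n) = if i = m 0 ∧ j = m 0 + m 1 then 1 else 0 := by
    rw [Finsupp.prod_fintype _ _ (by simp), Fin.prod_univ_two]
    simp only [Matrix.cons_val_zero, Matrix.cons_val_one]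
    rw [mul_pow, mul_assoc, ← pow_add, MvPowerSeries.X_pow_eq, MvPowerSeries.X_pow_eq,
      MvPowerSeries.monomial_mul_monomial, MvPowerSeries.coeff_monomial, one_mul]
    simp [Finsupp.ext_iff, Fin.forall_fin_two]
  rw [coeffTZ, MvPowerSeries.coeff_subst (MvPowerSeries.hasSubst_of_constantCoeff_zero
    (by simp [Fin.forall_fin_two]))]
  simp only [hprod]
  split_ifs with h
  · rw [finsum_eq_single _ (Finsupp.single 0 i + Finsupp.single 1 (j - i))]
    · simp [coeffTZ, h]
    · intro m hm
      rw [if_neg, smul_zero]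
      rintro ⟨rfl, rfl⟩
      rw [Nat.add_sub_cancel_left, single_zero_add_single_one] at hm
      exact hm rfl
  · exact finsum_eq_zero_of_forall_eq_zero fun m ↦ by rw [if_neg (by omega), smul_zero]

theorem coeffTZ_zero_tPsi (Ψ : MvPowerSeries (Fin 2) K) (j : ℕ) : coeffTZ 0 j (tPsi Ψ) = 0 := by
  simp [coeffTZ, tPsi, coeff_X_mul_eq_ite]

theorem coeffTZ_succ_tPsi (Ψ : MvPowerSeries (Fin 2) K) (n j : ℕ) :
    coeffTZ (n + 1) j (tPsi Ψ) = if n ≤ j then coeffTZ n (j - n) Ψ else 0 := by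
  rw [← coeffTZ_subst_X_mul_X, coeffTZ, tPsi, Finsupp.single_add, add_right_comm, add_comm,
    MvPowerSeries.X, MvPowerSeries.coeff_add_monomial_mul, one_mul, coeffTZ]

theorem exists_eq_tPsi_iff {F : MvPowerSeries (Fin 2) K} :
    (∃ Ψ, F = tPsi Ψ) ↔
      (∀ j, coeffTZ 0 j F = 0) ∧ ∀ n j, j < n → coeffTZ (n + 1) j F = 0 := by
  constructor
  · rintro ⟨Ψ, rfl⟩
    exact ⟨coeffTZ_zero_tPsi Ψ, fun n j hj ↦ by rw [coeffTZ_succ_tPsi, if_neg (by omega)]⟩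
  · rintro ⟨hzero, hsucc⟩
    let Ψ : MvPowerSeries (Fin 2) K := fun d ↦ coeffTZ (d 0 + 1) (d 0 + d 1) F
    have hΨ (m n : ℕ) : coeffTZ m n Ψ = coeffTZ (m + 1) (m + n) F := by
      change coeffTZ _ _ F = _
      simp
    refine ⟨Ψ, ext_coeffTZ fun i j ↦ ?_⟩
    rcases i with - | n
    · rw [hzero, coeffTZ_zero_tPsi]
    · rw [coeffTZ_succ_tPsi, hΨ]
      split_ifs with h
      · rw [Nat.add_sub_cancel' h]
      · exact hsucc n j (not_le.1 h)

theorem exists_eq_tPsi_of_mem_excessLE {F : MvPowerSeries (Fin 2) K} (hX : MvPowerSeries.X 0 ∣ F)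
    (hF : ∀ J, F ∈ excessLE 1 J) : ∃ Ψ, F = tPsi Ψ :=
  exists_eq_tPsi_iff.2 ⟨fun _ ↦ MvPowerSeries.X_dvd_iff.1 hX _ (by simp),
    fun _ j hj ↦ hF (j + 1) _ (by simp) (by simpa using hj)⟩

end Psi

section Exponent

variable {K : Type*} [CommRing K]

/-- The coefficient `∑_{m + n = p} c_{mn} x^{m+1}` of `z^p` in `x Φ(x z, z)`, as a polynomial in
`x`. -/
def exponentPoly (Φ : MvPowerSeries (Fin 2) K) (p : ℕ) : Polynomial K :=
  ∑ m ∈ Finset.univ.finsuppAntidiag p, Polynomial.monomial (m 0 + 1) (coeff m Φ)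

theorem natDegree_exponentPoly_le (Φ : MvPowerSeries (Fin 2) K) (p : ℕ) :
    (exponentPoly Φ p).natDegree ≤ p + 1 := by
  refine Polynomial.natDegree_sum_le_of_forall_le _ _ fun m hm ↦
    (Polynomial.natDegree_monomial_le _).trans ?_
  have hdeg := (Finset.mem_finsuppAntidiag.1 hm).1
  rw [Fin.sum_univ_two] at hdeg
  omega

theorem exponent_eq_mk (Φ : MvPowerSeries (Fin 2) K) (k : ℕ) :
    exponent Φ k = PowerSeries.mk fun p ↦ (exponentPoly Φ p).eval (k : K) := by
  classical
  ext p
  let a : Fin 2 → PowerSeries K := ![(k : K) • PowerSeries.X, PowerSeries.X]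
  have hs : MvPowerSeries.HasSubst a :=
    MvPowerSeries.hasSubst_of_constantCoeff_zero <|
      Fin.forall_fin_two.2 ⟨by simp [a, PowerSeries.X], by simp [a, PowerSeries.X]⟩
  have hprod (m : Fin 2 →₀ ℕ) : PowerSeries.coeff p (m.prod fun s n ↦ a s ^ n)
      = if m 0 + m 1 = p then (k : K) ^ m 0 else 0 := by
    rw [Finsupp.prod_fintype _ _ (by simp), Fin.prod_univ_two]
    simp only [a, Matrix.cons_val_zero, Matrix.cons_val_one]
    rw [smul_pow, smul_mul_assoc, ← pow_add, PowerSeries.coeff_smul, PowerSeries.coeff_X_pow]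
    simp [eq_comm]
  have hsubst : PowerSeries.coeff p (MvPowerSeries.subst a Φ : PowerSeries K)
      = ∑ᶠ m : Fin 2 →₀ ℕ, coeff m Φ • if m 0 + m 1 = p then (k : K) ^ m 0 else 0 := by
    simp only [← hprod]
    exact MvPowerSeries.coeff_subst hs Φ _
  rw [exponent, PowerSeries.coeff_smul, hsubst, PowerSeries.coeff_mk, exponentPoly,
    Polynomial.eval_finsetSum,
    finsum_eq_sum_of_support_subset (s := Finset.univ.finsuppAntidiag p), Finset.smul_sum]
  · refine Finset.sum_congr rfl fun m hm ↦ ?_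
    rw [Finset.mem_finsuppAntidiag, Fin.sum_univ_two] at hm
    rw [if_pos hm.1, Polynomial.eval_monomial, smul_eq_mul, smul_eq_mul, pow_succ']
    ring
  · intro m hm
    simp only [Finset.mem_coe, Finset.mem_finsuppAntidiag, Fin.sum_univ_two, Finset.subset_univ,
      and_true]
    by_contra h
    exact hm (by simp [h])

theorem constantCoeff_exponent (Φ : MvPowerSeries (Fin 2) K) (k : ℕ) :
    PowerSeries.constantCoeff (exponent Φ k) = k * constantCoeff Φ := by
  simp [exponent_eq_mk, exponentPoly, mul_comm]

end Exponent

section Exp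

variable {K : Type*} [CommRing K] [Algebra ℚ K]

theorem constantCoeff_formalExp {f : PowerSeries K} (hf : PowerSeries.constantCoeff f = 0) :
    PowerSeries.constantCoeff (formalExp f) = 1 := by
  rw [formalExp, ← PowerSeries.coeff_zero_eq_constantCoeff_apply,
    PowerSeries.coeff_subst' (PowerSeries.HasSubst.of_constantCoeff_zero' hf),
    finsum_eq_single _ 0 fun n hn ↦ by simp [hf, hn]]
  simp

theorem derivative_formalExp {f : PowerSeries K} (hf : PowerSeries.constantCoeff f = 0) :
    derivative K (formalExp f) = derivative K f * formalExp f := by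
  rw [formalExp, PowerSeries.derivative_subst (PowerSeries.HasSubst.of_constantCoeff_zero' hf),
    PowerSeries.derivative_exp, mul_comm]

theorem formalExp_zero : formalExp (0 : PowerSeries K) = 1 := by
  have h := PowerSeries.subst_zero_eq_C_constantCoeff (τ := Unit) (S := K) (f := PowerSeries.exp K)
  rw [PowerSeries.constantCoeff_exp] at h
  exact h.trans (by simp)

/-- The exponential of `f = a + g`, with `a` constant and `g` without constant term, in which the
given scalar `w` takes the place of `exp a`. It makes sense without a topology on `K` and
specializes to both `formalExp` and `analyticExp`. -/
def expWithConst (w : K) (f : PowerSeries K) : PowerSeries K :=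
  PowerSeries.C w * formalExp (f - PowerSeries.C (PowerSeries.constantCoeff f))

theorem constantCoeff_expWithConst (w : K) (f : PowerSeries K) :
    PowerSeries.constantCoeff (expWithConst w f) = w := by
  rw [expWithConst, map_mul, constantCoeff_formalExp (by simp), PowerSeries.constantCoeff_C,
    mul_one]

theorem derivative_expWithConst (w : K) (f : PowerSeries K) :
    derivative K (expWithConst w f) = derivative K f * expWithConst w f := by
  rw [expWithConst, Derivation.leibniz, derivative_formalExp (by simp), map_sub,
    PowerSeries.derivative_C, PowerSeries.derivative_C, sub_zero, smul_zero, add_zero,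
    smul_eq_mul, mul_left_comm]

theorem expWithConst_zero (w : K) : expWithConst w 0 = PowerSeries.C w := by
  simp [expWithConst, formalExp_zero]

theorem formalExp_eq_expWithConst {f : PowerSeries K} (hf : PowerSeries.constantCoeff f = 0) :
    formalExp f = expWithConst 1 f := by
  simp [expWithConst, hf]

theorem formalExp_exponent {Φ : MvPowerSeries (Fin 2) K} (hΦ : constantCoeff Φ = 0) (k : ℕ) :
    formalExp (exponent Φ k) = expWithConst (1 ^ k) (exponent Φ k) := by
  rw [one_pow, formalExp_eq_expWithConst (by rw [constantCoeff_exponent, hΦ, mul_zero])]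

theorem analyticExp_exponent {K : Type*} [NormedCommRing K] [NormedAlgebra ℚ K] [CompleteSpace K]
    (Φ : MvPowerSeries (Fin 2) K) (k : ℕ) :
    analyticExp (exponent Φ k)
      = expWithConst (NormedSpace.exp (constantCoeff Φ) ^ k) (exponent Φ k) := by
  rw [analyticExp, expWithConst, ← NormedSpace.exp_nsmul, nsmul_eq_mul, constantCoeff_exponent]

end Exp

end

end BouwkampDeBruijn

theorem mainTheorem1_general {K : Type*} [CommRing K] [Algebra ℚ K]
    (Φ : MvPowerSeries (Fin 2) K) (w : K) :
    ∃ Ψ : MvPowerSeries (Fin 2) K,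
      formalLog (expGenFun fun k ↦ expWithConst (w ^ k) (exponent Φ k)) = tPsi Ψ := by
  apply exists_eq_tPsi_of_mem_excessLE
  · apply X_dvd_formalLog
    apply X_zero_dvd_expGenFun_sub_one
    simp [exponent, expWithConst_zero]
  · apply formalLog_expGenFun_mem_excessLE (natDegree_exponentPoly_le Φ)
    · exact fun k ↦ constantCoeff_expWithConst (w ^ k) _
    · exact fun k ↦ exponent_eq_mk Φ k ▸ derivative_expWithConst (w ^ k) _

theorem mainTheorem1 :
    -- coefficients in a complete normed commutative algebra (such as `ℝ` or `ℂ`), any `Φ`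
    (∀ (K : Type*) [NormedCommRing K] [NormedAlgebra ℚ K] [CompleteSpace K]
        (Φ : MvPowerSeries (Fin 2) K),
      (∃ Ψ : MvPowerSeries (Fin 2) K,
        formalLog (expGenFun fun k ↦ analyticExp (exponent Φ k)) = tPsi Ψ) ∧
      (∀ j : ℕ, coeffTZ 0 j
        (formalLog (expGenFun fun k ↦ analyticExp (exponent Φ k))) = 0) ∧
      (∀ n j : ℕ, j < n → coeffTZ (n + 1) j
        (formalLog (expGenFun fun k ↦ analyticExp (exponent Φ k))) = 0)) ∧
    -- coefficients in an arbitrary commutative `ℚ`-algebra, `Φ(0, 0) = 0`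
    (∀ (K : Type*) [CommRing K] [Algebra ℚ K] (Φ : MvPowerSeries (Fin 2) K),
      MvPowerSeries.constantCoeff Φ = 0 →
      (∃ Ψ : MvPowerSeries (Fin 2) K,
        formalLog (expGenFun fun k ↦ formalExp (exponent Φ k)) = tPsi Ψ) ∧
      (∀ j : ℕ, coeffTZ 0 j
        (formalLog (expGenFun fun k ↦ formalExp (exponent Φ k))) = 0) ∧
      (∀ n j : ℕ, j < n → coeffTZ (n + 1) j
        (formalLog (expGenFun fun k ↦ formalExp (exponent Φ k))) = 0)) :=
  ⟨fun K _ _ _ Φ ↦ by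
    simpa only [analyticExp_exponent, ← exists_eq_tPsi_iff, and_self] using
      mainTheorem1_general Φ (NormedSpace.exp (MvPowerSeries.constantCoeff Φ)),
  fun K _ _ Φ hΦ ↦ by
    simpa only [formalExp_exponent hΦ, ← exists_eq_tPsi_iff, and_self] using
      mainTheorem1_general Φ 1⟩
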